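/- **Theorem (Arnold's conjecture on hyperbolic homogeneous polynomials).** Let $n\ge 1$ be an integer. For $f\in\mathbb R[x,y]$, a point of the graph $z=f(x,y)$ in $\mathbb R^3$ is called *hyperbolic* if exactly two of the straight lines tangent to the graph at that point have contact of order at least $3$ with the graph there (here the contact order of a line with the graph at a point is the order of vanishing at that point of the restriction of $f(x,y)-z$ to the line). Let $\mathrm{Hyp}(n)$ be the set of real homogeneous polynomials of degree $n$ in two variables whose graph has only hyperbolic points off the origin, with the topology induced from the finite-dimensional real vector space of forms of degree $n$ in $x,y$. Let $N(n)\in\{0,1,2,\dots\}\cup\{\infty\}$ be the number of connected components of $\mathrm{Hyp}(n)$. Then $$N(n)\ \ge\ \left[\frac{n-1}{2}\right]\qquad\text{for every integer } n\ge 1,$$ where $[\cdot]$ denotes the integer part. In particular $N(n)$ grows at least linearly in $n$: there is a positive integer $C$ such that $N(n)\ge n/C$ for all $n\ge 3$. -/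

import Mathlib

noncomputable section

/-- The restriction to the parametrized line `t ↦ q + t w` in `ℝ³` of the function
`f(x, y) - z`, whose zero set is the graph of `f`; it is a polynomial in `t`. -/
def restrictToLine (f : MvPolynomial (Fin 2) ℝ) (q w : Fin 3 → ℝ) : Polynomial ℝ :=
  MvPolynomial.aeval
      ![Polynomial.C (q 0) + Polynomial.C (w 0) * Polynomial.X,
        Polynomial.C (q 1) + Polynomial.C (w 1) * Polynomial.X] f
    - (Polynomial.C (q 2) + Polynomial.C (w 2) * Polynomial.X)

/-- The line `q + L` (where `L` is a one-dimensional subspace of `ℝ³`) has contact of order at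
least `k` at `q` with the graph of `f`: the defining function of the graph, restricted to
the line, vanishes to order at least `k` at `q`. -/
def HasContactAtLeast (f : MvPolynomial (Fin 2) ℝ) (q : Fin 3 → ℝ)
    (L : Submodule ℝ (Fin 3 → ℝ)) (k : ℕ) : Prop :=
  ∀ w ∈ L, Polynomial.X ^ k ∣ restrictToLine f q w

/-- The point of the graph of `f` over `p = (x, y)`. -/
def graphPoint (f : MvPolynomial (Fin 2) ℝ) (p : Fin 2 → ℝ) : Fin 3 → ℝ :=
  ![p 0, p 1, MvPolynomial.eval p f]

/-- The (directions of the) asymptotic lines of the graph of `f` at the point over `p`: the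
straight lines tangent to the graph there (contact of order at least `2`) whose contact
with the graph at that point has order at least `3`. -/
def asymptoticLines (f : MvPolynomial (Fin 2) ℝ) (p : Fin 2 → ℝ) :
    Set (Submodule ℝ (Fin 3 → ℝ)) :=
  {L | Module.finrank ℝ L = 1 ∧ HasContactAtLeast f (graphPoint f p) L 2 ∧
    HasContactAtLeast f (graphPoint f p) L 3}

/-- The point of the graph of `f` over `p` is hyperbolic: it has exactly two asymptotic lines. -/
def IsHyperbolicPoint (f : MvPolynomial (Fin 2) ℝ) (p : Fin 2 → ℝ) : Prop :=
  (asymptoticLines f p).encard = 2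

/-- The space `Hyp(n)`: real homogeneous polynomials of degree `n` in two variables whose graph
has only hyperbolic points off the origin. -/
def Hyp (n : ℕ) : Type :=
  {f : MvPolynomial (Fin 2) ℝ //
    f.IsHomogeneous n ∧ ∀ p : Fin 2 → ℝ, p ≠ 0 → IsHyperbolicPoint f p}

/-- `Hyp(n)` carries the topology of convergence of all coefficients, that is, the topology
induced by the usual one of the finite-dimensional space of forms of degree `n`. -/
instance Hyp.instTopologicalSpace (n : ℕ) : TopologicalSpace (Hyp n) :=
  TopologicalSpace.induced
    (fun f : Hyp n => fun d : Fin 2 →₀ ℕ => MvPolynomial.coeff d f.1) inferInstance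

/-- The number of connected components of `Hyp(n)` (`⊤` if it is infinite). -/
def numComponents (n : ℕ) : ℕ∞ :=
  ENat.card (ConnectedComponents (Hyp n))

end

noncomputable section

open MvPolynomial

/-! ### Hyperbolic points and the Hessian -/

/-! The invariant separating the components is the number of zeros of a form on the unit circle,
twice its number of real linear factors. Substituting a line into the graph shows that a point is
hyperbolic exactly when the Hessian determinant is negative (`isHyperbolicPoint_iff`). By Euler's
identities, for a form `f` of degree `n + 1` the Hessian times `r ^ 4` equals `f` times a factor,
minus `n ^ 2` times the squared angular derivative (`hessianDet_polar`). Hence a hyperbolic form has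
only simple zeros on the circle, and their number is constant on each component
(`isLocallyConstant_ncard_zeros`).

It remains to realize many values. For odd `N ≥ 3` the form `x ^ N + y ^ N - (x + y) ^ N` is
hyperbolic with exactly three real linear factors, and multiplication by a linear form not dividing
a hyperbolic form of degree at least 2 keeps it hyperbolic (`hessianDet_linearForm_mul_neg`). Degree
`k + 2 + j` with `k` odd thus admits `j + 3` real factors; the parity condition leaves `(n - 1) / 2`
choices of `j` in degree `n`. -/

theorem MvPolynomial.pderiv_comm {σ R : Type*} [CommRing R] (i j : σ) (f : MvPolynomial σ R) :
    pderiv i (pderiv j f) = pderiv j (pderiv i f) := by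
  classical
  -- The commutator of two derivations is a derivation, so it suffices that it kills the variables.
  have h : ⁅pderiv (R := R) i, pderiv (R := R) j⁆ = 0 := by
    ext k
    simp [Derivation.commutator_apply, pderiv_X, Pi.single_apply, apply_ite]
  have := congrArg (fun D => D f) h
  simpa [Derivation.commutator_apply, sub_eq_zero] using this

/-- The Hessian determinant of `f` at `p`. -/
def hessianDet (f : MvPolynomial (Fin 2) ℝ) (p : Fin 2 → ℝ) : ℝ :=
  eval p (pderiv 0 (pderiv 0 f)) * eval p (pderiv 1 (pderiv 1 f))
    - eval p (pderiv 0 (pderiv 1 f)) ^ 2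

/-- The second fundamental form of the graph (up to a positive factor), as a quadratic form. -/
def hessianForm (f : MvPolynomial (Fin 2) ℝ) (p : Fin 2 → ℝ) (u v : ℝ) : ℝ :=
  eval p (pderiv 0 (pderiv 0 f)) * u ^ 2 + 2 * eval p (pderiv 0 (pderiv 1 f)) * u * v
    + eval p (pderiv 1 (pderiv 1 f)) * v ^ 2

theorem derivative_aeval_fin_two (g : Fin 2 → Polynomial ℝ) (f : MvPolynomial (Fin 2) ℝ) :
    Polynomial.derivative (aeval g f) =
      aeval g (pderiv 0 f) * Polynomial.derivative (g 0)
        + aeval g (pderiv 1 f) * Polynomial.derivative (g 1) := by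
  induction f using MvPolynomial.induction_on with
  | C a => simp
  | add p q hp hq => simp only [map_add, hp, hq]; ring
  | mul_X p i hp =>
    simp only [map_mul, aeval_X, Polynomial.derivative_mul, hp, pderiv_mul, map_add]
    fin_cases i <;> simp [pderiv_X] <;> ring

/-- Second-order Taylor expansion along the line: the constant coefficient vanishes, the linear one
measures tangency, and twice the quadratic one is the Hessian form. -/
theorem X_pow_three_dvd_restrictToLine_iff (f : MvPolynomial (Fin 2) ℝ) (p : Fin 2 → ℝ)
    (w : Fin 3 → ℝ) :
    Polynomial.X ^ 3 ∣ restrictToLine f (graphPoint f p) w ↔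
      w 2 = eval p (pderiv 0 f) * w 0 + eval p (pderiv 1 f) * w 1 ∧
        hessianForm f p (w 0) (w 1) = 0 := by
  set g : Fin 2 → Polynomial ℝ := ![Polynomial.C (p 0) + Polynomial.C (w 0) * Polynomial.X,
        Polynomial.C (p 1) + Polynomial.C (w 1) * Polynomial.X] with hg
  have e0 : ∀ h : MvPolynomial (Fin 2) ℝ, (aeval g h).eval 0 = eval p h := by
    intro h
    have : ((Polynomial.evalRingHom (0 : ℝ)).comp (aeval g).toRingHom) = eval p := by
      apply MvPolynomial.ringHom_ext
      · intro r; simp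
      · intro i; fin_cases i <;> simp [hg]
    exact congrArg (fun F => F h) this
  have d0 : Polynomial.derivative (g 0) = Polynomial.C (w 0) := by simp [hg]
  have d1 : Polynomial.derivative (g 1) = Polynomial.C (w 1) := by simp [hg]
  have hR : restrictToLine f (graphPoint f p) w =
      aeval g f - (Polynomial.C (eval p f) + Polynomial.C (w 2) * Polynomial.X) := rfl
  have c0 : (restrictToLine f (graphPoint f p) w).coeff 0 = 0 := by
    rw [hR, Polynomial.coeff_zero_eq_eval_zero]; simp [e0]
  have D1 : Polynomial.derivative (restrictToLine f (graphPoint f p) w) =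
      aeval g (pderiv 0 f) * Polynomial.C (w 0) + aeval g (pderiv 1 f) * Polynomial.C (w 1)
        - Polynomial.C (w 2) := by
    rw [hR, map_sub, derivative_aeval_fin_two, d0, d1]; simp
  have c1 : (restrictToLine f (graphPoint f p) w).coeff 1 =
      eval p (pderiv 0 f) * w 0 + eval p (pderiv 1 f) * w 1 - w 2 := by
    have := Polynomial.coeff_derivative (restrictToLine f (graphPoint f p) w) 0
    rw [D1, Polynomial.coeff_zero_eq_eval_zero] at this
    simp [e0] at this
    linarith
  have c2 : 2 * (restrictToLine f (graphPoint f p) w).coeff 2 = hessianForm f p (w 0) (w 1) := by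
    have h1 := Polynomial.coeff_derivative (restrictToLine f (graphPoint f p) w) 1
    have h2 := Polynomial.coeff_derivative
      (Polynomial.derivative (restrictToLine f (graphPoint f p) w)) 0
    rw [D1, Polynomial.coeff_zero_eq_eval_zero] at h2
    simp only [map_sub, map_add, Polynomial.derivative_mul, derivative_aeval_fin_two, d0, d1,
      Polynomial.derivative_C, Polynomial.eval_add, Polynomial.eval_sub, Polynomial.eval_mul, e0,
      Polynomial.eval_C, Polynomial.eval_zero] at h2
    rw [← D1] at h2
    rw [pderiv_comm 1 0] at h2
    unfold hessianForm
    norm_num at h1 h2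
    linarith
  rw [Polynomial.X_pow_dvd_iff]
  constructor
  · intro h
    have h1 := h 1 (by norm_num)
    have h2 := h 2 (by norm_num)
    exact ⟨by linarith, by rw [← c2, h2, mul_zero]⟩
  · rintro ⟨h1, h2⟩ d hd
    interval_cases d
    · exact c0
    · rw [c1]; linarith
    · linarith

/-- The tangent vector of the graph of `f` over `p` that projects to `(u, v)`. -/
def tangentLift (f : MvPolynomial (Fin 2) ℝ) (p : Fin 2 → ℝ) (u v : ℝ) : Fin 3 → ℝ :=
  ![u, v, eval p (pderiv 0 f) * u + eval p (pderiv 1 f) * v]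

theorem span_tangentLift_mem_asymptoticLines {f : MvPolynomial (Fin 2) ℝ} {p : Fin 2 → ℝ}
    {u v : ℝ} (h0 : u ≠ 0 ∨ v ≠ 0) (h : hessianForm f p u v = 0) :
    Submodule.span ℝ {tangentLift f p u v} ∈ asymptoticLines f p := by
  have h3 : HasContactAtLeast f (graphPoint f p) (Submodule.span ℝ {tangentLift f p u v}) 3 := by
    intro w hw
    obtain ⟨c, rfl⟩ := Submodule.mem_span_singleton.1 hw
    rw [X_pow_three_dvd_restrictToLine_iff]
    simp only [tangentLift, hessianForm] at h ⊢
    constructor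
    · simp; ring
    · simp; linear_combination c ^ 2 * h
  refine ⟨finrank_span_singleton ?_, fun w hw => (pow_dvd_pow _ (by norm_num)).trans (h3 w hw), h3⟩
  intro h
  have e0 := congrFun h 0
  have e1 := congrFun h 1
  simp [tangentLift] at e0 e1
  tauto

theorem exists_eq_span_tangentLift {f : MvPolynomial (Fin 2) ℝ} {p : Fin 2 → ℝ}
    {L : Submodule ℝ (Fin 3 → ℝ)} (hL : L ∈ asymptoticLines f p) :
    ∃ u v, (u ≠ 0 ∨ v ≠ 0) ∧ hessianForm f p u v = 0 ∧
      L = Submodule.span ℝ {tangentLift f p u v} := by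
  obtain ⟨h1, -, h3⟩ := hL
  obtain ⟨w, hw0, hw⟩ := finrank_eq_one_iff'.1 h1
  have hw3 := (X_pow_three_dvd_restrictToLine_iff f p w).1 (h3 w w.2)
  have hwt : (w : Fin 3 → ℝ) = tangentLift f p (w.1 0) (w.1 1) := by
    ext i; fin_cases i
    · rfl
    · rfl
    · exact hw3.1
  refine ⟨w.1 0, w.1 1, ?_, hw3.2, ?_⟩
  · by_contra! h
    apply hw0
    ext i
    rw [hwt]
    fin_cases i <;> simp [tangentLift, h.1, h.2]
  · rw [← hwt]
    apply le_antisymm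
    · intro x hx
      obtain ⟨c, hc⟩ := hw ⟨x, hx⟩
      exact Submodule.mem_span_singleton.2 ⟨c, congrArg Subtype.val hc⟩
    · rw [Submodule.span_singleton_le_iff_mem]; exact w.2

theorem span_tangentLift_eq_iff {f : MvPolynomial (Fin 2) ℝ} {p : Fin 2 → ℝ} {u v u' v' : ℝ}
    (h : u ≠ 0 ∨ v ≠ 0) (h' : u' ≠ 0 ∨ v' ≠ 0) :
    Submodule.span ℝ {tangentLift f p u v} = Submodule.span ℝ {tangentLift f p u' v'} ↔
      u * v' - u' * v = 0 := by
  constructor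
  · intro e
    have : tangentLift f p u v ∈ Submodule.span ℝ {tangentLift f p u' v'} :=
      e ▸ Submodule.mem_span_singleton_self _
    obtain ⟨c, hc⟩ := Submodule.mem_span_singleton.1 this
    have e0 := congrFun hc 0
    have e1 := congrFun hc 1
    simp [tangentLift] at e0 e1
    rw [← e0, ← e1]; ring
  · intro e
    have : ∃ c : ℝ, c ≠ 0 ∧ u = c * u' ∧ v = c * v' := by
      by_cases hu : u' = 0
      · have hv : v' ≠ 0 := by tauto
        have hu0 : u = 0 := by simpa [hu, hv] using e
        exact ⟨v / v', div_ne_zero (by tauto) hv, by simp [hu, hu0], by field_simp⟩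
      · refine ⟨u / u', div_ne_zero ?_ hu, by field_simp, by field_simp; linarith⟩
        rintro rfl
        have : v = 0 := by simpa [hu] using e
        tauto
    obtain ⟨c, hc, rfl, rfl⟩ := this
    have : tangentLift f p (c * u') (c * v') = c • tangentLift f p u' v' := by
      ext i; fin_cases i <;> simp [tangentLift]; ring
    rw [this, Submodule.span_singleton_smul_eq (IsUnit.mk0 c hc)]

theorem exists_nullVectors_of_disc_neg {a b c : ℝ} (h : a * c - b ^ 2 < 0) :
    ∃ u v u' v' : ℝ, u * v' - u' * v ≠ 0 ∧ a * u ^ 2 + 2 * b * u * v + c * v ^ 2 = 0 ∧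
      a * u' ^ 2 + 2 * b * u' * v' + c * v' ^ 2 = 0 := by
  by_cases ha : a = 0
  · subst ha
    have hb : b ≠ 0 := by rintro rfl; simp at h
    exact ⟨1, 0, -c, 2 * b, by simpa using hb, by ring, by ring⟩
  · obtain ⟨s, hs0, hs⟩ : ∃ s : ℝ, 0 < s ∧ s ^ 2 = b ^ 2 - a * c :=
      ⟨√(b ^ 2 - a * c), Real.sqrt_pos.2 (by linarith), Real.sq_sqrt (by linarith)⟩
    -- The quadratic formula for `u / v`, cleared of the denominator `a`.
    refine ⟨-b + s, a, -b - s, a, ?_, by linear_combination a * hs, by linear_combination a * hs⟩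
    have : (-b + s) * a - (-b - s) * a = 2 * s * a := by ring
    rw [this]; positivity

/-- A point is hyperbolic if and only if the Hessian is negative there. -/
theorem isHyperbolicPoint_iff (f : MvPolynomial (Fin 2) ℝ) (p : Fin 2 → ℝ) :
    IsHyperbolicPoint f p ↔ hessianDet f p < 0 := by
  unfold IsHyperbolicPoint
  set a := eval p (pderiv 0 (pderiv 0 f)) with ha
  set b := eval p (pderiv 0 (pderiv 1 f)) with hb
  set c := eval p (pderiv 1 (pderiv 1 f)) with hc
  have hQ : ∀ u v, hessianForm f p u v = a * u ^ 2 + 2 * b * u * v + c * v ^ 2 := fun _ _ => rfl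
  have hD : hessianDet f p = a * c - b ^ 2 := rfl
  have hne : ∀ {u v u' v' : ℝ}, u * v' - u' * v ≠ 0 → (u ≠ 0 ∨ v ≠ 0) ∧ (u' ≠ 0 ∨ v' ≠ 0) := by
    intro u v u' v' h
    constructor <;> (by_contra! h'; apply h; rw [h'.1, h'.2]; ring)
  constructor
  · intro h
    obtain ⟨L, L', hLL', hS⟩ := Set.encard_eq_two.1 h
    obtain ⟨u, v, h0, h1, rfl⟩ := exists_eq_span_tangentLift (hS ▸ (by simp) : L ∈ asymptoticLines f p)
    obtain ⟨u', v', h0', h1', rfl⟩ :=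
      exists_eq_span_tangentLift (hS ▸ (by simp) : L' ∈ asymptoticLines f p)
    have hd : u * v' - u' * v ≠ 0 := fun e => hLL' ((span_tangentLift_eq_iff h0 h0').2 e)
    by_contra! hcon
    rw [hQ] at h1 h1'
    rw [hD] at hcon
    -- Gram determinant of two null vectors: both diagonal entries vanish, so a nonnegative Hessian
    -- forces their polar pairing to be zero.
    have key : (a * c - b ^ 2) * (u * v' - u' * v) ^ 2 =
        - (a * u * u' + b * (u * v' + u' * v) + c * v * v') ^ 2 := by
      linear_combination (a * u' ^ 2 + 2 * b * u' * v' + c * v' ^ 2) * h1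
    have hB : a * u * u' + b * (u * v' + u' * v) + c * v * v' = 0 := by
      have := mul_nonneg hcon (sq_nonneg (u * v' - u' * v))
      rw [key] at this
      nlinarith
    -- The sum of two orthogonal null vectors is null and parallel to neither, giving a forbidden
    -- third asymptotic line.
    have hd1 : (u + u') * v' - u' * (v + v') ≠ 0 := by convert hd using 1; ring
    have hd2 : (u + u') * v - u * (v + v') ≠ 0 := by
      intro e; apply hd; linear_combination -e
    have hmem := span_tangentLift_mem_asymptoticLines (f := f) (p := p) (hne hd1).1
      (by rw [hQ]; linear_combination h1 + h1' + 2 * hB)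
    rw [hS] at hmem
    rcases hmem with e | e
    · exact hd2 ((span_tangentLift_eq_iff (hne hd1).1 h0).1 e)
    · exact hd1 ((span_tangentLift_eq_iff (hne hd1).1 h0').1 e)
  · intro h
    rw [hD] at h
    obtain ⟨u, v, u', v', hd, h1, h1'⟩ := exists_nullVectors_of_disc_neg h
    obtain ⟨h0, h0'⟩ := hne hd
    rw [Set.encard_eq_two]
    refine ⟨_, _, fun e => hd ((span_tangentLift_eq_iff h0 h0').1 e), Set.Subset.antisymm ?_
      (Set.pair_subset (span_tangentLift_mem_asymptoticLines h0 (by rw [hQ, h1]))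
        (span_tangentLift_mem_asymptoticLines h0' (by rw [hQ, h1'])))⟩
    intro L hL
    obtain ⟨x, y, hxy, hz, rfl⟩ := exists_eq_span_tangentLift hL
    rw [hQ] at hz
    have hB : a * u * u' + b * (u * v' + u' * v) + c * v * v' ≠ 0 := by
      intro hB
      have key : (a * c - b ^ 2) * (u * v' - u' * v) ^ 2 = 0 := by
        linear_combination (a * u' ^ 2 + 2 * b * u' * v' + c * v' ^ 2) * h1
          - (a * u * u' + b * (u * v' + u' * v) + c * v * v') * hB
      rcases mul_eq_zero.1 key with e | e
      · exact h.ne e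
      · exact hd (pow_eq_zero_iff two_ne_zero |>.1 e)
    -- Expand `(x, y)` in the basis of the two null vectors: its Hessian form is a multiple of the
    -- product of its coordinates and the polar pairing.
    have key : (x * v - u * y) * (x * v' - u' * y)
        * (a * u * u' + b * (u * v' + u' * v) + c * v * v') = 0 := by
      have h2 : 2 * ((x * v - u * y) * (x * v' - u' * y)
        * (a * u * u' + b * (u * v' + u' * v) + c * v * v')) = 0 := by
        linear_combination (x * v' - u' * y) ^ 2 * h1 + (x * v - u * y) ^ 2 * h1'
          - (u * v' - u' * v) ^ 2 * hz
      linarith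
    rcases mul_eq_zero.1 key with e | e
    · rcases mul_eq_zero.1 e with e | e
      · exact Or.inl ((span_tangentLift_eq_iff hxy h0).2 e)
      · exact Or.inr ((span_tangentLift_eq_iff hxy h0').2 e)
    · exact absurd e hB

/-! ### The number of simple zeros is locally constant -/

open Filter Topology in
-- Each point of the finite fibre `Z x` continues to exactly one nearby point of `Z y`, and
-- compactness of `S` excludes new points elsewhere.
theorem isLocallyConstant_ncard_of_local {X S : Type*} [TopologicalSpace X] [TopologicalSpace S]
    [CompactSpace S] [T2Space S] (Z : X → Set S)
    (hclosed : IsClosed {q : X × S | q.2 ∈ Z q.1})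
    (hsub : ∀ x, ∀ s ∈ Z x, ∃ V ∈ 𝓝 s, ∀ᶠ y in 𝓝 x, (Z y ∩ V).Subsingleton)
    (hne : ∀ x, ∀ s ∈ Z x, ∀ V ∈ 𝓝 s, ∀ᶠ y in 𝓝 x, (Z y ∩ V).Nonempty) :
    IsLocallyConstant fun x => (Z x).ncard := by
  rw [IsLocallyConstant.iff_eventually_eq]
  intro x
  have hZc : IsClosed (Z x) := hclosed.preimage (Continuous.prodMk_right x)
  have hfin : (Z x).Finite := by
    refine hZc.isCompact.finite (isDiscrete_iff_forall_mem_exists_isOpen.2 fun s hs => ?_)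
    obtain ⟨V, hV, hV'⟩ := hsub x s hs
    obtain ⟨U, hUV, hU, hsU⟩ := mem_nhds_iff.1 hV
    refine ⟨U, hU, Set.Subset.antisymm ?_ (by simpa using ⟨hsU, hs⟩)⟩
    rintro t ⟨ht, ht'⟩
    exact hV'.self_of_nhds ⟨ht', hUV ht⟩ ⟨hs, hUV hsU⟩
  obtain ⟨U, hU, hdisj⟩ := hfin.t2_separation
  choose! W hW hWsub using hsub x
  have hVn : ∀ s ∈ Z x, U s ∩ interior (W s) ∈ 𝓝 s := fun s hs =>
    inter_mem ((hU s).2.mem_nhds (hU s).1) (interior_mem_nhds.2 (hW s hs))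
  have hVo : ∀ s, IsOpen (U s ∩ interior (W s)) := fun s => (hU s).2.inter isOpen_interior
  have h1 : ∀ᶠ y in 𝓝 x, ∀ s ∈ Z x, (Z y ∩ W s).Subsingleton :=
    (eventually_all_finite hfin).2 hWsub
  have h2 : ∀ᶠ y in 𝓝 x, ∀ s ∈ Z x, (Z y ∩ (U s ∩ interior (W s))).Nonempty :=
    (eventually_all_finite hfin).2 fun s hs => hne x s hs _ (hVn s hs)
  -- Off the chosen neighbourhoods `Z x` is empty; closedness of the total set and compactness
  -- spread this to all nearby `y`.
  have hK : IsCompact (⋃ s ∈ Z x, U s ∩ interior (W s))ᶜ :=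
    (isOpen_biUnion fun s _ => hVo s).isClosed_compl.isCompact
  have h3 : ∀ᶠ y in 𝓝 x, ∀ t ∈ (⋃ s ∈ Z x, U s ∩ interior (W s))ᶜ, t ∉ Z y := by
    refine hK.eventually_forall_of_forall_eventually fun t ht => ?_
    refine hclosed.isOpen_compl.mem_nhds (show (x, t) ∈ _ from fun h => ht ?_)
    exact Set.mem_biUnion h (mem_of_mem_nhds (hVn t h))
  filter_upwards [h1, h2, h3] with y h1 h2 h3
  choose! g hg using h2
  refine (Set.ncard_congr (fun s _ => g s) (fun s hs => (hg s hs).1) ?_ ?_).symm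
  · intro s t hs ht hst
    by_contra hne
    exact Set.disjoint_left.1 (hdisj hs ht hne) (hg s hs).2.1 (hst ▸ (hg t ht).2.1)
  · intro t ht
    have : t ∈ ⋃ s ∈ Z x, U s ∩ interior (W s) := by
      by_contra h; exact h3 t h ht
    obtain ⟨s, hs, hts⟩ := Set.mem_iUnion₂.1 this
    exact ⟨s, hs, h1 s hs ⟨(hg s hs).1, interior_subset (hg s hs).2.2⟩
      ⟨ht, interior_subset hts.2⟩⟩

theorem Real.Angle.nhds_coe (t : ℝ) :
    nhds (t : Real.Angle) = Filter.map ((↑) : ℝ → Real.Angle) (nhds t) := by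
  refine le_antisymm ?_ Real.Angle.continuous_coe.continuousAt
  exact (QuotientAddGroup.isOpenMap_coe (N := AddSubgroup.zmultiples (2 * Real.pi))).nhds_le t

instance : CompactSpace Real.Angle :=
  haveI : Fact (0 < 2 * Real.pi) := ⟨by positivity⟩
  inferInstanceAs (CompactSpace (AddCircle (2 * Real.pi)))

open Filter Topology in
/-- For a continuous family of functions on the circle with only simple zeros, the number of
zeros is locally constant. -/
theorem isLocallyConstant_ncard_zeros {X : Type*} [TopologicalSpace X]
    (E : X → Real.Angle → ℝ) (D : X → ℝ → ℝ)
    (hE : Continuous fun q : X × Real.Angle => E q.1 q.2)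
    (hD : Continuous fun q : X × ℝ => D q.1 q.2)
    (hder : ∀ x (t : ℝ), HasDerivAt (fun t : ℝ => E x t) (D x t) t)
    (hsimple : ∀ x (t : ℝ), E x t = 0 → D x t ≠ 0) :
    IsLocallyConstant fun x => {s | E x s = 0}.ncard := by
  have hEc : ∀ x, Continuous fun t : ℝ => E x t := fun x =>
    (hE.comp (Continuous.prodMk_right x)).comp Real.Angle.continuous_coe
  have hD0 : ∀ x (t : ℝ), E x t = 0 → ∃ δ > 0, ∀ᶠ y in 𝓝 x, ∀ r ∈ Metric.ball t δ, D y r ≠ 0 := by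
    intro x t h
    have : ∀ᶠ q in 𝓝 x ×ˢ 𝓝 t, D q.1 q.2 ≠ 0 := by
      rw [← nhds_prod_eq]
      exact hD.continuousAt.eventually_ne (hsimple x t h)
    obtain ⟨p, hp, q, hq, hpq⟩ := eventually_prod_iff.1 this
    obtain ⟨δ, hδ, hδ'⟩ := Metric.mem_nhds_iff.1 hq
    exact ⟨δ, hδ, hp.mono fun y hy r hr => hpq hy (hδ' hr)⟩
  -- Rolle's theorem: two zeros, or any two equal values, would produce a zero of the derivative.
  have hinj : ∀ x (t δ : ℝ), (∀ r ∈ Metric.ball t δ, D x r ≠ 0) →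
      Set.InjOn (fun r : ℝ => E x r) (Metric.ball t δ) := by
    intro x t δ h
    have key : ∀ a ∈ Metric.ball t δ, ∀ b ∈ Metric.ball t δ, a < b → E x a ≠ E x b := by
      intro a ha b hb hab e
      obtain ⟨c, hc, hc0⟩ := exists_hasDerivAt_eq_zero (f' := D x) hab (hEc x).continuousOn e
        (fun r _ => hder x r)
      rw [Real.ball_eq_Ioo] at ha hb h
      exact h c ⟨ha.1.trans hc.1, hc.2.trans hb.2⟩ hc0
    intro a ha b hb e
    rcases lt_trichotomy a b with h1 | h1 | h1
    · exact absurd e (key a ha b hb h1)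
    · exact h1
    · exact absurd e.symm (key b hb a ha h1)
  apply isLocallyConstant_ncard_of_local
  · exact isClosed_eq hE continuous_const
  · intro x s hs
    induction s using Real.Angle.induction_on with | _ t => ?_
    obtain ⟨δ, hδ, h⟩ := hD0 x t hs
    refine ⟨(↑) '' Metric.ball t δ, ?_, ?_⟩
    · rw [Real.Angle.nhds_coe]; exact image_mem_map (Metric.ball_mem_nhds t hδ)
    · filter_upwards [h] with y hy
      rintro _ ⟨ha, a, ha', rfl⟩ _ ⟨hb, b, hb', rfl⟩
      rw [hinj y t δ hy ha' hb' (ha.trans hb.symm)]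
  · intro x s hs V hV
    induction s using Real.Angle.induction_on with | _ t => ?_
    obtain ⟨δ, hδ, h⟩ := hD0 x t hs
    rw [Real.Angle.nhds_coe, mem_map] at hV
    obtain ⟨ε, hε, hεV⟩ := Metric.mem_nhds_iff.1 hV
    obtain ⟨η, hη, hηδ, hηε⟩ : ∃ η > 0, η < δ ∧ η < ε :=
      ⟨min δ ε / 2, by positivity, by have := min_le_left δ ε; linarith [lt_min hδ hε],
        by have := min_le_right δ ε; linarith [lt_min hδ hε]⟩
    have hsub : Set.Icc (t - η) (t + η) ⊆ Metric.ball t δ := by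
      rw [Real.ball_eq_Ioo]; intro r hr; constructor <;> linarith [hr.1, hr.2]
    have hsub' : Set.Icc (t - η) (t + η) ⊆ Metric.ball t ε := by
      rw [Real.ball_eq_Ioo]; intro r hr; constructor <;> linarith [hr.1, hr.2]
    have hi := (hinj x t δ h.self_of_nhds).mono hsub
    have hcont : ∀ r : ℝ, Continuous fun y => E y r := fun r =>
      hE.comp (Continuous.prodMk_left (r : Real.Angle))
    have hle : t - η ≤ t + η := by linarith
    have hivt : ∀ᶠ y in 𝓝 x, ∃ r ∈ Set.Icc (t - η) (t + η), E y r = 0 := by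
      have ha : t - η ∈ Set.Icc (t - η) (t + η) := ⟨le_rfl, hle⟩
      have hb : t + η ∈ Set.Icc (t - η) (t + η) := ⟨hle, le_rfl⟩
      have hm : t ∈ Set.Icc (t - η) (t + η) := ⟨by linarith, by linarith⟩
      -- An injective continuous function on an interval is strictly monotone, so it changes sign at
      -- `t`; the endpoint signs persist for nearby `y`.
      rcases (hEc x).continuousOn.strictMonoOn_of_injOn_Icc' hle hi with hmono | hanti
      · have h1 : E x ↑(t - η) < 0 := hs ▸ hmono ha hm (by linarith)
        have h2 : 0 < E x ↑(t + η) := hs ▸ hmono hm hb (by linarith)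
        filter_upwards [(hcont _).continuousAt.eventually_lt_const h1,
          (hcont _).continuousAt.eventually_const_lt h2] with y h1 h2
        exact intermediate_value_Icc hle (hEc y).continuousOn ⟨h1.le, h2.le⟩
      · have h1 : 0 < E x ↑(t - η) := hs ▸ hanti ha hm (by linarith)
        have h2 : E x ↑(t + η) < 0 := hs ▸ hanti hm hb (by linarith)
        filter_upwards [(hcont _).continuousAt.eventually_const_lt h1,
          (hcont _).continuousAt.eventually_lt_const h2] with y h1 h2
        exact intermediate_value_Icc' hle (hEc y).continuousOn ⟨h2.le, h1.le⟩
    exact hivt.mono fun y ⟨r, hr, h0⟩ => ⟨r, h0, hεV (hsub' hr)⟩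

/-! ### Euler's identities and products with linear forms -/

theorem MvPolynomial.IsHomogeneous.euler_fin_two {f : MvPolynomial (Fin 2) ℝ} {n : ℕ}
    (hf : f.IsHomogeneous n) (p : Fin 2 → ℝ) :
    p 0 * eval p (pderiv 0 f) + p 1 * eval p (pderiv 1 f) = n * eval p f := by
  simpa using congrArg (eval p) hf.sum_X_mul_pderiv

/-- The Hessian expressed through radial and angular derivatives. -/
theorem MvPolynomial.IsHomogeneous.hessianDet_polar {f : MvPolynomial (Fin 2) ℝ} {n : ℕ}
    (hf : f.IsHomogeneous (n + 1)) (p : Fin 2 → ℝ) :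
    (p 0 ^ 2 + p 1 ^ 2) ^ 2 * hessianDet f p =
      n * (n + 1) * eval p f * hessianForm f p (-p 1) (p 0)
        - n ^ 2 * (p 0 * eval p (pderiv 1 f) - p 1 * eval p (pderiv 0 f)) ^ 2 := by
  have h1 := hf.euler_fin_two p
  have h2 := (hf.pderiv (i := 0)).euler_fin_two p
  have h3 := (hf.pderiv (i := 1)).euler_fin_two p
  rw [pderiv_comm 1 0] at h2
  push_cast [Nat.add_sub_cancel] at h1 h2 h3
  -- Gram determinant of the Hessian form in the orthogonal frame `p`, `(-p 1, p 0)`, whose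
  -- determinant is `r ^ 2`; Euler's identities supply the entries involving `p`.
  have hp : hessianForm f p (p 0) (p 1) = n * (n + 1) * eval p f := by
    unfold hessianForm
    linear_combination p 0 * h2 + p 1 * h3 + n * h1
  have hpt : p 0 * (p 0 * eval p (pderiv 0 (pderiv 1 f)) + p 1 * eval p (pderiv 1 (pderiv 1 f)))
      - p 1 * (p 0 * eval p (pderiv 0 (pderiv 0 f)) + p 1 * eval p (pderiv 0 (pderiv 1 f)))
      = n * (p 0 * eval p (pderiv 1 f) - p 1 * eval p (pderiv 0 f)) := by
    linear_combination p 0 * h3 - p 1 * h2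
  rw [← hp, ← mul_pow, ← hpt]
  unfold hessianDet hessianForm
  ring

theorem sq_add_sq_pos_of_ne_zero {p : Fin 2 → ℝ} (hp : p ≠ 0) : 0 < p 0 ^ 2 + p 1 ^ 2 := by
  by_contra! h
  apply hp
  ext i
  fin_cases i
  · simp; nlinarith [sq_nonneg (p 0), sq_nonneg (p 1)]
  · simp; nlinarith [sq_nonneg (p 0), sq_nonneg (p 1)]

/-- The linear form `α x + β y`. -/
def linearForm (α β : ℝ) : MvPolynomial (Fin 2) ℝ := C α * X 0 + C β * X 1

theorem isHomogeneous_linearForm (α β : ℝ) : (linearForm α β).IsHomogeneous 1 :=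
  (isHomogeneous_C_mul_X _ _).add (isHomogeneous_C_mul_X _ _)

@[simp] theorem eval_linearForm (α β : ℝ) (p : Fin 2 → ℝ) :
    eval p (linearForm α β) = α * p 0 + β * p 1 := by simp [linearForm]

@[simp] theorem pderiv_zero_linearForm (α β : ℝ) : pderiv 0 (linearForm α β) = C α := by
  simp [linearForm, pderiv_X]

@[simp] theorem pderiv_one_linearForm (α β : ℝ) : pderiv 1 (linearForm α β) = C β := by
  simp [linearForm, pderiv_X]

/-- Multiplying a hyperbolic form by a linear form that does not divide it preserves
hyperbolicity. -/
theorem hessianDet_linearForm_mul_neg {f : MvPolynomial (Fin 2) ℝ} {n : ℕ} (hn : 0 < n)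
    (hf : f.IsHomogeneous (n + 1)) {p : Fin 2 → ℝ} (hp : p ≠ 0) (hneg : hessianDet f p < 0)
    {α β : ℝ} (hαβ : α ≠ 0 ∨ β ≠ 0) (h0 : α * p 0 + β * p 1 = 0 → eval p f ≠ 0) :
    hessianDet (linearForm α β * f) p < 0 := by
  have hg : (linearForm α β * f).IsHomogeneous (n + 1 + 1) := by
    have := (isHomogeneous_linearForm α β).mul hf
    rwa [add_comm 1] at this
  have hr := sq_add_sq_pos_of_ne_zero hp
  have e1 := hf.hessianDet_polar p
  have e2 := hg.hessianDet_polar p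
  set l := α * p 0 + β * p 1 with hl
  set lt := p 0 * β - p 1 * α with hlt
  set s := hessianForm f p (-p 1) (p 0) with hs
  set ft := p 0 * eval p (pderiv 1 f) - p 1 * eval p (pderiv 0 f) with hft
  set F := eval p f with hF
  have hs' : hessianForm (linearForm α β * f) p (-p 1) (p 0) = l * s + 2 * lt * ft := by
    simp only [hessianForm, hs, pderiv_mul, map_add, map_mul, pderiv_zero_linearForm,
      pderiv_one_linearForm, pderiv_C, eval_linearForm, eval_C, map_zero]
    rw [hl, hlt, hft]; ring
  have ht' : p 0 * eval p (pderiv 1 (linearForm α β * f))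
      - p 1 * eval p (pderiv 0 (linearForm α β * f)) = l * ft + lt * F := by
    simp only [pderiv_mul, map_add, map_mul, pderiv_zero_linearForm,
      pderiv_one_linearForm, eval_linearForm, eval_C]
    rw [hl, hlt, hft]; ring
  rw [hs', ht', map_mul, eval_linearForm, ← hl, ← hF] at e2
  push_cast at e2
  have hn' : (0 : ℝ) < n := by exact_mod_cast hn
  -- Completing the square leaves a positive multiple of `l ^ 2` times the old Hessian, minus a
  -- square that is nonzero where `l` vanishes.
  have key : n * ((p 0 ^ 2 + p 1 ^ 2) ^ 2 * hessianDet (linearForm α β * f) p) =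
      (n + 2) * l ^ 2 * ((p 0 ^ 2 + p 1 ^ 2) ^ 2 * hessianDet f p)
        - n * (l * ft - (n + 1) * lt * F) ^ 2 := by
    rw [e1, e2]; ring
  have hlt0 : l = 0 → lt ≠ 0 := by
    intro h1 h2
    -- Lagrange's identity: `l ^ 2 + lt ^ 2` is the product of the squared norms.
    have : (p 0 ^ 2 + p 1 ^ 2) * (α ^ 2 + β ^ 2) = 0 := by
      linear_combination l * h1 + lt * h2 + (α * p 0 + β * p 1 + l) * hl
        + (p 0 * β - p 1 * α + lt) * hlt
    rcases mul_eq_zero.1 this with h | h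
    · exact hr.ne' h
    · have : 0 < α ^ 2 + β ^ 2 := by rcases hαβ with h' | h' <;> positivity
      exact this.ne' h
  have hfin : n * ((p 0 ^ 2 + p 1 ^ 2) ^ 2 * hessianDet (linearForm α β * f) p) < 0 := by
    rw [key]
    by_cases h : l = 0
    · have : 0 < (((n : ℝ) + 1) * lt * F) ^ 2 :=
        sq_pos_of_ne_zero (mul_ne_zero (mul_ne_zero (by positivity) (hlt0 h)) (h0 h))
      have h2 := mul_pos hn' this
      rw [h]
      linear_combination h2
    · have h1 : 0 < ((n : ℝ) + 2) * l ^ 2 * (p 0 ^ 2 + p 1 ^ 2) ^ 2 := by positivity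
      have h2 := mul_neg_of_pos_of_neg h1 hneg
      have h3 := mul_nonneg hn'.le (sq_nonneg (l * ft - (n + 1) * lt * F))
      rw [← mul_assoc]
      linarith
  by_contra! hcon
  have : 0 ≤ n * ((p 0 ^ 2 + p 1 ^ 2) ^ 2 * hessianDet (linearForm α β * f) p) := by positivity
  linarith

/-! ### The form `x ^ N + y ^ N - (x + y) ^ N` -/

/-- Among three reals of sum zero two have the same weak sign, so rotation and a global sign change
reduce to this case. -/
theorem exists_same_sign_of_add_eq_zero {P : ℝ → ℝ → ℝ → Prop}
    (hrot : ∀ a b c, P a b c → P b c a)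
    (hneg : ∀ a b c, P a b c → P (-a) (-b) (-c))
    (h : ∀ a b, 0 ≤ a → 0 ≤ b → P a b (-(a + b))) {a b c : ℝ} (habc : a + b + c = 0) :
    P a b c := by
  have h2 : ∀ a b c : ℝ, a + b + c = 0 → 0 ≤ a → 0 ≤ b → P a b c := by
    intro a b c h1 ha hb
    have := h a b ha hb
    rwa [show -(a + b) = c by linarith] at this
  have h3 : ∀ a b c : ℝ, a + b + c = 0 → a ≤ 0 → b ≤ 0 → P a b c := by
    intro a b c h1 ha hb
    have := hneg _ _ _ (h2 (-a) (-b) (-c) (by linarith) (by linarith) (by linarith))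
    simpa using this
  rcases le_total 0 a with ha | ha <;> rcases le_total 0 b with hb | hb <;>
    rcases le_total 0 c with hc | hc
  · exact h2 a b c habc ha hb
  · exact h2 a b c habc ha hb
  · exact hrot _ _ _ (h2 c a b (by linarith) hc ha)
  · exact hrot _ _ _ (hrot _ _ _ (h3 b c a (by linarith) hb hc))
  · exact hrot _ _ _ (hrot _ _ _ (h2 b c a (by linarith) hb hc))
  · exact hrot _ _ _ (h3 c a b (by linarith) hc ha)
  · exact h3 a b c habc ha hb
  · exact h3 a b c habc ha hb

theorem odd_pow_esymm_two_neg {k : ℕ} (hk : Odd k) {a b c : ℝ} (h : a + b + c = 0)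
    (h0 : a ≠ 0 ∨ b ≠ 0) : a ^ k * b ^ k + b ^ k * c ^ k + c ^ k * a ^ k < 0 := by
  refine exists_same_sign_of_add_eq_zero (P := fun a b c => (a ≠ 0 ∨ b ≠ 0 ∨ c ≠ 0) →
    a ^ k * b ^ k + b ^ k * c ^ k + c ^ k * a ^ k < 0) ?_ ?_ ?_ h (by tauto)
  · intro a b c h h'
    linarith [h (by tauto)]
  · intro a b c h h'
    have := h (by simpa using h')
    simp only [hk.neg_pow]
    linarith
  · intro a b ha hb h'
    have h1 : a ^ k ≤ (a + b) ^ k := by gcongr; linarith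
    have h2 : b ^ k ≤ (a + b) ^ k := by gcongr; linarith
    have h3 : 0 ≤ a ^ k := by positivity
    have h4 : 0 ≤ b ^ k := by positivity
    have h5 : 0 < a ^ k ∨ 0 < b ^ k := by
      rcases ha.eq_or_lt with rfl | ha
      · rcases hb.eq_or_lt with rfl | hb
        · simp at h'
        · right; positivity
      · left; positivity
    -- As `(a + b) ^ k` dominates `a ^ k` and `b ^ k`, the sum to be bounded is at most the negative
    -- of this quantity.
    have h6 : 0 < (a ^ k) ^ 2 + (b ^ k) ^ 2 - a ^ k * b ^ k := by
      rcases h5 with h5 | h5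
      · nlinarith [sq_nonneg (a ^ k - 2 * b ^ k), mul_pos h5 h5]
      · nlinarith [sq_nonneg (b ^ k - 2 * a ^ k), mul_pos h5 h5]
    rw [hk.neg_pow]
    nlinarith [mul_nonneg h3 (sub_nonneg.2 h1), mul_nonneg h4 (sub_nonneg.2 h2)]

theorem odd_pow_sum_eq_zero {N : ℕ} (hN : Odd N) (hN2 : 2 ≤ N) {a b c : ℝ} (h : a + b + c = 0)
    (hs : a ^ N + b ^ N + c ^ N = 0) : a = 0 ∨ b = 0 ∨ c = 0 := by
  refine exists_same_sign_of_add_eq_zero (P := fun a b c => a ^ N + b ^ N + c ^ N = 0 →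
    a = 0 ∨ b = 0 ∨ c = 0) ?_ ?_ ?_ h hs
  · intro a b c h h'
    have := h (by linarith)
    tauto
  · intro a b c h h'
    simp only [hN.neg_pow] at h'
    simpa using h (by linarith)
  · intro a b ha hb h'
    by_contra! hcon
    have ha' : 0 < a := lt_of_le_of_ne ha hcon.1.symm
    have hb' : 0 < b := lt_of_le_of_ne hb hcon.2.1.symm
    obtain ⟨M, rfl⟩ : ∃ M, N = M + 1 := ⟨N - 1, by omega⟩
    have hM : M ≠ 0 := by omega
    have h1 : a ^ M < (a + b) ^ M := pow_lt_pow_left₀ (by linarith) ha hM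
    have h2 : b ^ M < (a + b) ^ M := pow_lt_pow_left₀ (by linarith) hb hM
    rw [hN.neg_pow, pow_succ, pow_succ, pow_succ] at h'
    nlinarith [mul_pos ha' (sub_pos.2 h1), mul_pos hb' (sub_pos.2 h2)]

/-- The form `x ^ N + y ^ N - (x + y) ^ N`. -/
def fermatForm (N : ℕ) : MvPolynomial (Fin 2) ℝ := X 0 ^ N + X 1 ^ N - (X 0 + X 1) ^ N

theorem isHomogeneous_fermatForm (N : ℕ) : (fermatForm N).IsHomogeneous N := by
  have h0 := (isHomogeneous_X ℝ (0 : Fin 2)).pow N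
  have h1 := (isHomogeneous_X ℝ (1 : Fin 2)).pow N
  have h2 := ((isHomogeneous_X ℝ (0 : Fin 2)).add (isHomogeneous_X ℝ (1 : Fin 2))).pow N
  rw [one_mul] at h0 h1 h2
  exact (h0.add h1).sub h2

theorem hessianDet_fermatForm_neg {k : ℕ} (hk : Odd k) {p : Fin 2 → ℝ} (hp : p ≠ 0) :
    hessianDet (fermatForm (k + 2)) p < 0 := by
  have h0 : p 0 ≠ 0 ∨ p 1 ≠ 0 := by
    by_contra! h
    exact hp (by ext i; fin_cases i <;> simp [h.1, h.2])
  have h := odd_pow_esymm_two_neg hk (c := -(p 0 + p 1)) (by ring) h0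
  rw [hk.neg_pow] at h
  -- With `c = -(x + y)` and odd exponents the form is `a ^ N + b ^ N + c ^ N`, and its Hessian is a
  -- multiple of the second symmetric function of the `k`-th powers.
  have e : hessianDet (fermatForm (k + 2)) p = (((k : ℝ) + 2) * (k + 1)) ^ 2 *
      (p 0 ^ k * p 1 ^ k + p 1 ^ k * -(p 0 + p 1) ^ k + -(p 0 + p 1) ^ k * p 0 ^ k) := by
    have h2 : ∀ i, pderiv i (2 : MvPolynomial (Fin 2) ℝ) = 0 := fun i => pderiv_C (a := 2)
    simp [hessianDet, fermatForm, pderiv_X, h2]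
    ring
  rw [e]
  exact mul_neg_of_pos_of_neg (by positivity) h

theorem eval_fermatForm_eq_zero_iff {N : ℕ} (hN : Odd N) (hN2 : 2 ≤ N) (p : Fin 2 → ℝ) :
    eval p (fermatForm N) = 0 ↔ p 0 = 0 ∨ p 1 = 0 ∨ p 0 + p 1 = 0 := by
  have hN0 : N ≠ 0 := by omega
  have e : eval p (fermatForm N) = p 0 ^ N + p 1 ^ N + (-(p 0 + p 1)) ^ N := by
    rw [hN.neg_pow]; simp [fermatForm]; ring
  rw [e]
  constructor
  · intro h
    have := odd_pow_sum_eq_zero hN hN2 (by ring) h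
    rwa [neg_eq_zero] at this
  · rintro (h | h | h)
    · simp [h, hN0, hN.neg_pow]
    · simp [h, hN0, hN.neg_pow]
    · rw [h, eq_neg_of_add_eq_zero_left h, hN.neg_pow]; simp [hN0]

/-! ### Zeros on the circle -/

/-- The point of the unit circle with a given angle. -/
def circlePoint (s : Real.Angle) : Fin 2 → ℝ := ![s.cos, s.sin]

theorem circlePoint_ne_zero (s : Real.Angle) : circlePoint s ≠ 0 := by
  intro h
  have h0 := congrFun h 0
  have h1 := congrFun h 1
  simp only [circlePoint, Matrix.cons_val_zero, Matrix.cons_val_one, Pi.zero_apply] at h0 h1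
  have := Real.Angle.cos_sq_add_sin_sq s
  rw [h0, h1] at this
  norm_num at this

/-- The zeros of `f` on the unit circle. -/
def circleZeros (f : MvPolynomial (Fin 2) ℝ) : Set Real.Angle :=
  {s | eval (circlePoint s) f = 0}

theorem encard_circleZeros_linearForm {α β : ℝ} (h : α ≠ 0 ∨ β ≠ 0) :
    (circleZeros (linearForm α β)).encard = 2 := by
  have hr : 0 < α ^ 2 + β ^ 2 := by
    rcases h with h | h <;> positivity
  obtain ⟨r, hr0, ψ, hα, hβ⟩ : ∃ r : ℝ, r ≠ 0 ∧ ∃ ψ : Real.Angle,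
      α = -(r * ψ.sin) ∧ β = r * ψ.cos := by
    -- Polar coordinates of `β - α i` turn the linear form on the circle into `r * sin (s - ψ)`.
    have hz : (⟨β, -α⟩ : ℂ) ≠ 0 := by
      intro e
      rw [Complex.ext_iff] at e
      simp at e
      tauto
    refine ⟨‖(⟨β, -α⟩ : ℂ)‖, by simpa using hz, (Complex.arg ⟨β, -α⟩ : ℝ), ?_, ?_⟩
    · rw [Real.Angle.sin_coe, Complex.norm_mul_sin_arg]; simp
    · rw [Real.Angle.cos_coe, Complex.norm_mul_cos_arg]
  have e : circleZeros (linearForm α β) = {ψ, ψ + (Real.pi : Real.Angle)} := by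
    ext s
    have h1 : eval (circlePoint s) (linearForm α β) = r * (s - ψ).sin := by
      rw [eval_linearForm, sub_eq_add_neg, Real.Angle.sin_add, Real.Angle.sin_neg,
        Real.Angle.cos_neg, hα, hβ]
      simp [circlePoint]; ring
    rw [circleZeros, Set.mem_ofPred_eq, h1, mul_eq_zero, or_iff_right hr0,
      Real.Angle.sin_eq_zero_iff, sub_eq_zero, sub_eq_iff_eq_add, add_comm]
    rfl
  rw [e, Set.encard_pair]
  intro h
  exact Real.Angle.pi_ne_zero (left_eq_add.1 h)

theorem encard_circleZeros_linearForm_mul {f : MvPolynomial (Fin 2) ℝ} {α β : ℝ}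
    (h : α ≠ 0 ∨ β ≠ 0) (h0 : ∀ p : Fin 2 → ℝ, p ≠ 0 → α * p 0 + β * p 1 = 0 → eval p f ≠ 0) :
    (circleZeros (linearForm α β * f)).encard = 2 + (circleZeros f).encard := by
  have e : circleZeros (linearForm α β * f) = circleZeros (linearForm α β) ∪ circleZeros f := by
    ext s; simp [circleZeros]
  rw [e, Set.encard_union_eq, encard_circleZeros_linearForm h]
  rw [Set.disjoint_left]
  intro s hs hs'
  rw [circleZeros, Set.mem_ofPred_eq, eval_linearForm] at hs
  exact h0 _ (circlePoint_ne_zero s) hs hs'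

theorem encard_circleZeros_fermatForm {N : ℕ} (hN : Odd N) (hN2 : 2 ≤ N) :
    (circleZeros (fermatForm N)).encard = 6 := by
  have e : circleZeros (fermatForm N) =
      circleZeros (linearForm 1 0 * (linearForm 0 1 * (linearForm 1 1 * 1))) := by
    ext s
    simp [circleZeros, eval_fermatForm_eq_zero_iff hN hN2]
  have hne : ∀ p : Fin 2 → ℝ, p ≠ 0 → p 0 = 0 → p 1 = 0 → False := by
    intro p hp h0 h1
    exact hp (by ext i; fin_cases i <;> simp [h0, h1])
  rw [e, encard_circleZeros_linearForm_mul (by simp), encard_circleZeros_linearForm_mul (by simp),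
    encard_circleZeros_linearForm_mul (by simp)]
  · have : circleZeros 1 = ∅ := by ext s; simp [circleZeros]
    rw [this, Set.encard_empty]; norm_num
  · simp
  · intro p hp h
    simp only [zero_mul, one_mul, zero_add] at h
    simpa [h] using fun h0 => hne p hp h0 h
  · intro p hp h
    simp only [zero_mul, one_mul, add_zero] at h
    simpa [h] using fun h1 => hne p hp h h1

/-- Hyperbolic forms of degree `k + 2 + j` with `j + 3` real linear factors. -/
theorem exists_hyperbolic_form {k : ℕ} (hk : Odd k) (j : ℕ) :
    ∃ f : MvPolynomial (Fin 2) ℝ, f.IsHomogeneous (k + 2 + j) ∧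
      (∀ p : Fin 2 → ℝ, p ≠ 0 → hessianDet f p < 0) ∧
      (circleZeros f).encard = ((2 * j + 6 : ℕ) : ℕ∞) ∧
      ∀ c : ℝ, j < c → ∀ p : Fin 2 → ℝ, p ≠ 0 → p 0 = c * p 1 → eval p f ≠ 0 := by
  induction j with
  | zero =>
    have hN : Odd (k + 2) := hk.add_even even_two
    refine ⟨fermatForm (k + 2), isHomogeneous_fermatForm _, fun p => hessianDet_fermatForm_neg hk,
      by rw [encard_circleZeros_fermatForm hN (by omega)]; rfl, fun c hc p hp h => ?_⟩
    rw [Ne, eval_fermatForm_eq_zero_iff hN (by omega), h]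
    rw [Nat.cast_zero] at hc
    have h1 : p 1 ≠ 0 := by
      intro h1
      exact hp (by ext i; fin_cases i <;> simp [h, h1])
    rintro (e | e | e)
    · exact mul_ne_zero hc.ne' h1 e
    · exact h1 e
    · exact mul_ne_zero (by linarith : c + 1 ≠ 0) h1 (by linarith)
  | succ j ih =>
    obtain ⟨f, hf, hneg, hcard, hz⟩ := ih
    -- The new factor is `x - (j + 1) y`; the last clause of the induction guarantees that this line
    -- is not yet a zero of `f`.
    have hz' : ∀ p : Fin 2 → ℝ, p ≠ 0 → 1 * p 0 + -((j : ℝ) + 1) * p 1 = 0 → eval p f ≠ 0 :=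
      fun p hp h => hz (j + 1) (by linarith) p hp (by linarith)
    refine ⟨linearForm 1 (-(j + 1)) * f, ?_, fun p hp => ?_, ?_, fun c hc p hp h => ?_⟩
    · have := (isHomogeneous_linearForm 1 (-((j : ℝ) + 1))).mul hf
      rwa [add_comm 1] at this
    · exact hessianDet_linearForm_mul_neg (n := k + 1 + j) (by omega)
        (by convert hf using 1; omega) hp (hneg p hp) (by simp) (hz' p hp)
    · rw [encard_circleZeros_linearForm_mul (by simp) hz', hcard]
      norm_cast
      ring
    · push_cast at hc
      rw [map_mul, eval_linearForm]
      refine mul_ne_zero ?_ (hz c (by linarith) p hp h)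
      have h1 : p 1 ≠ 0 := by
        intro h1
        exact hp (by ext i; fin_cases i <;> simp [h, h1])
      have : 1 * p 0 + -((j : ℝ) + 1) * p 1 = (c - (j + 1)) * p 1 := by rw [h]; ring
      rw [this]
      exact mul_ne_zero (by linarith) h1

/-! ### Continuity of the evaluation -/

/-- Homogeneity confines all supports to one finite set of exponents, so coefficientwise continuity
suffices. -/
theorem continuous_eval_of_isHomogeneous {X : Type*} [TopologicalSpace X] {n : ℕ}
    (φ : X → MvPolynomial (Fin 2) ℝ) (hφ : ∀ x, (φ x).IsHomogeneous n)
    (hc : ∀ d, Continuous fun x => coeff d (φ x)) :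
    Continuous fun q : X × (Fin 2 → ℝ) => eval q.2 (φ q.1) := by
  have e : (fun q : X × (Fin 2 → ℝ) => eval q.2 (φ q.1)) = fun q =>
      ∑ d ∈ Finset.finsuppAntidiag Finset.univ n, coeff d (φ q.1) * ∏ i, q.2 i ^ d i := by
    ext q
    rw [eval_eq']
    refine Finset.sum_subset (fun d hd => ?_) (fun d _ hd => ?_)
    · rw [Finset.mem_finsuppAntidiag]
      refine ⟨?_, Finset.subset_univ _⟩
      rw [(hφ q.1).degree_eq_sum_deg_support hd]
      exact (Finset.sum_subset (Finset.subset_univ _)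
        fun i _ hi => Finsupp.notMem_support_iff.1 hi).symm
    · rw [notMem_support_iff.1 hd, zero_mul]
  rw [e]
  refine continuous_finsetSum _ fun d _ => ((hc d).comp continuous_fst).mul ?_
  fun_prop

theorem hasDerivAt_eval_circlePoint (f : MvPolynomial (Fin 2) ℝ) (t : ℝ) :
    HasDerivAt (fun t : ℝ => eval (circlePoint t) f)
      (circlePoint t 0 * eval (circlePoint t) (pderiv 1 f)
        - circlePoint t 1 * eval (circlePoint t) (pderiv 0 f)) t := by
  induction f using MvPolynomial.induction_on with
  | C a => simpa using hasDerivAt_const t a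
  | add p q hp hq =>
    simp only [map_add]
    convert! hp.add hq using 1
    ring
  | mul_X p i hp =>
    have hX : HasDerivAt (fun t : ℝ => eval (circlePoint t) (X i))
        (circlePoint t 0 * eval (circlePoint t) (pderiv 1 (X i))
        - circlePoint t 1 * eval (circlePoint t) (pderiv 0 (X i))) t := by
      fin_cases i
      · simpa [circlePoint, pderiv_X] using Real.hasDerivAt_cos t
      · simpa [circlePoint, pderiv_X] using Real.hasDerivAt_sin t
    simp only [map_mul, pderiv_mul, map_add]
    convert! hp.mul hX using 1
    ring

theorem continuous_circlePoint : Continuous circlePoint := by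
  refine continuous_pi fun i => ?_
  fin_cases i
  · exact Real.Angle.continuous_cos
  · exact Real.Angle.continuous_sin

/-! ### Components of the space of hyperbolic forms -/

theorem Hyp.continuous_coeff {n : ℕ} (d : Fin 2 →₀ ℕ) :
    Continuous fun f : Hyp n => coeff d f.1 :=
  (continuous_apply d).comp continuous_induced_dom

theorem isLocallyConstant_ncard_circleZeros (n : ℕ) :
    IsLocallyConstant fun f : Hyp n => (circleZeros f.1).ncard := by
  have hc0 : Continuous fun q : Hyp n × (Fin 2 → ℝ) => eval q.2 q.1.1 :=
    continuous_eval_of_isHomogeneous (fun f : Hyp n => f.1) (fun f => f.2.1)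
      Hyp.continuous_coeff
  have hc : ∀ i : Fin 2, Continuous fun q : Hyp n × (Fin 2 → ℝ) => eval q.2 (pderiv i q.1.1) :=
    fun i => continuous_eval_of_isHomogeneous (fun f : Hyp n => pderiv i f.1)
      (fun f => f.2.1.pderiv) fun d => by
        simp_rw [coeff_pderiv]
        exact (Hyp.continuous_coeff _).mul continuous_const
  have hp : Continuous fun t : ℝ => circlePoint t :=
    continuous_circlePoint.comp Real.Angle.continuous_coe
  have hpi : ∀ i, Continuous fun t : ℝ => circlePoint t i := fun i => (continuous_apply i).comp hp
  have hE : Continuous fun q : Hyp n × Real.Angle => eval (circlePoint q.2) q.1.1 := by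
    have hq : Continuous fun q : Hyp n × Real.Angle => (q.1, circlePoint q.2) :=
      continuous_fst.prodMk (continuous_circlePoint.comp continuous_snd)
    have h := hc0.comp hq
    exact h
  have hD : Continuous fun q : Hyp n × ℝ =>
      circlePoint q.2 0 * eval (circlePoint q.2) (pderiv 1 q.1.1)
        - circlePoint q.2 1 * eval (circlePoint q.2) (pderiv 0 q.1.1) := by
    have hq : Continuous fun q : Hyp n × ℝ => (q.1, circlePoint q.2) :=
      continuous_fst.prodMk (hp.comp continuous_snd)
    have hx : ∀ i, Continuous fun q : Hyp n × ℝ => circlePoint q.2 i :=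
      fun i => (hpi i).comp continuous_snd
    have hd : ∀ i, Continuous fun q : Hyp n × ℝ => eval (circlePoint q.2) (pderiv i q.1.1) :=
      fun i => by
        have h := (hc i).comp hq
        exact h
    exact ((hx 0).mul (hd 1)).sub ((hx 1).mul (hd 0))
  have hsimple : ∀ (f : Hyp n) (t : ℝ), eval (circlePoint t) f.1 = 0 →
      circlePoint t 0 * eval (circlePoint t) (pderiv 1 f.1)
        - circlePoint t 1 * eval (circlePoint t) (pderiv 0 f.1) ≠ 0 := by
    intro f t h h'
    have hneg := (isHyperbolicPoint_iff _ _).1 (f.2.2 _ (circlePoint_ne_zero t))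
    have hr := sq_add_sq_pos_of_ne_zero (circlePoint_ne_zero t)
    -- The polar identity needs positive degree; a constant has zero Hessian and is never
    -- hyperbolic.
    rcases n with _ | n
    · have h1 : ∀ i, pderiv i f.1 = 0 := fun i => by
        rw [totalDegree_eq_zero_iff_eq_C.1 ((totalDegree_zero_iff_isHomogeneous _).2 f.2.1), pderiv_C]
      simp [hessianDet, h1] at hneg
    · have := f.2.1.hessianDet_polar (circlePoint t)
      rw [h, h'] at this
      have h3 := mul_neg_of_pos_of_neg (pow_pos hr 2) hneg
      rw [this] at h3
      norm_num at h3
  exact isLocallyConstant_ncard_zeros (fun (f : Hyp n) s => eval (circlePoint s) f.1) _ hE hD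
    (fun f t => hasDerivAt_eval_circlePoint f.1 t) hsimple

theorem le_numComponents (n : ℕ) : (((n - 1) / 2 : ℕ) : ℕ∞) ≤ numComponents n := by
  have hex : ∀ i : Fin ((n - 1) / 2), ∃ f : Hyp n,
      (circleZeros f.1).ncard = 2 * (2 * i + (n + 1) % 2) + 6 := by
    intro i
    -- The term `(n + 1) % 2` gives `j` the parity that makes `k = n - 2 - j` odd; `i < (n - 1) / 2`
    -- ensures `k ≥ 1`.
    obtain ⟨k, hk, hkn⟩ : ∃ k, Odd k ∧ k + 2 + (2 * i + (n + 1) % 2) = n :=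
      ⟨n - 2 - (2 * i + (n + 1) % 2), by rw [Nat.odd_iff]; omega, by omega⟩
    obtain ⟨f, hf, hneg, hcard, -⟩ := exists_hyperbolic_form hk (2 * i + (n + 1) % 2)
    rw [hkn] at hf
    exact ⟨⟨f, hf, fun p hp => (isHyperbolicPoint_iff f p).2 (hneg p hp)⟩,
      by rw [Set.ncard, hcard]; rfl⟩
  choose f hf using hex
  have hcont := (isLocallyConstant_ncard_circleZeros n).continuous
  have hinj : Function.Injective fun i => (f i : ConnectedComponents (Hyp n)) := by
    intro i j hij
    have h := congrArg hcont.connectedComponentsLift hij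
    simp only [Continuous.connectedComponentsLift_apply_coe, hf] at h
    exact Fin.ext (by omega)
  simpa [numComponents] using ENat.card_le_card_of_injective hinj

end

theorem theorem4p4 :
    (∀ n : ℕ, 1 ≤ n → (((n - 1) / 2 : ℕ) : ℕ∞) ≤ numComponents n) ∧
      ∃ C : ℕ, 0 < C ∧ ∀ n : ℕ, 3 ≤ n → (n : ℕ∞) ≤ (C : ℕ∞) * numComponents n := by
  -- The constant 4 is the least for which `n ≤ C * ((n - 1) / 2)` holds at `n = 4`.
  refine ⟨fun n _ => le_numComponents n, 4, by norm_num, fun n hn => ?_⟩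
  calc (n : ℕ∞) ≤ ((4 * ((n - 1) / 2) : ℕ) : ℕ∞) := by exact_mod_cast (by omega)
    _ = (4 : ℕ) * (((n - 1) / 2 : ℕ) : ℕ∞) := by push_cast; rfl
    _ ≤ _ := by gcongr; exact le_numComponents n
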